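/- Let $(N,g)$ be a compact connected smooth Riemannian manifold of dimension $n$ that is homogeneous, i.e. whose isometry group acts transitively on $N$, and let $G$ be the identity component of the isometry group of $N$ (with the compact-open topology). Let $\phi : N \to \mathbb{E}^m$ be a smooth isometric immersion into the Euclidean space $\mathbb{E}^m$ that is equivariant: there exists a Lie group homomorphism $\psi : G \to SO(m)$ such that $\phi(q(p)) = \psi(q)(\phi(p))$ for all $q \in G$ and $p \in N$. Let $\mathbf{x}^T$ be the canonical vector field of $\phi$, i.e. the tangent vector field on $N$ such that, for each $p \in N$, $d\phi_p(\mathbf{x}^T_p)$ is the orthogonal projection of the position vector $\phi(p)$ onto $d\phi_p(T_pN)$. Then $\mathbf{x}^T$ is incompressible: $\operatorname{div}(\mathbf{x}^T) = \sum_{i=1}^n \langle \nabla_{e_i}\mathbf{x}^T, e_i\rangle = 0$ at every point of $N$, where $\nabla$ is the Levi-Civita connection of $(N,g)$ and $e_1,\dots,e_n$ is an orthonormal basis of the tangent space at the point. -/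

import Mathlib

open Bundle Manifold Topology
open scoped ContDiff InnerProductSpace

noncomputable section

section IsometryGroup

variable {N : Type*} [MetricSpace N] [CompactSpace N]

/-- The inclusion of the isometry group of `N` into the space of continuous self-maps of `N`. -/
def isometryToContinuousMap (f : N ≃ᵢ N) : C(N, N) := ⟨f, f.continuous⟩

/-- The compact-open topology on the isometry group of `N`. -/
instance isometryGroupTopology : TopologicalSpace (N ≃ᵢ N) :=
  TopologicalSpace.induced isometryToContinuousMap inferInstance

theorem tendsto_isometry_iff {α : Type*} {l : Filter α} {F : α → (N ≃ᵢ N)} {f : N ≃ᵢ N} :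
    Filter.Tendsto F l (𝓝 f) ↔
      ∀ ε > 0, ∀ᶠ a in l, ∀ x, dist (F a x) (f x) < ε := by
  rw [nhds_induced, Filter.tendsto_comap_iff, Metric.tendsto_nhds]
  refine ⟨fun h ε hε => (h ε hε).mono fun a ha x =>
      (ContinuousMap.dist_apply_le_dist x).trans_lt ha,
    fun h ε hε => (h (ε / 2) (half_pos hε)).mono fun a ha => ?_⟩
  exact ((ContinuousMap.dist_le (half_pos hε).le).2 fun x => (ha x).le).trans_lt (half_lt_self hε)

instance isometryGroup_isTopologicalGroup : IsTopologicalGroup (N ≃ᵢ N) where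
  continuous_mul := by
    refine continuous_iff_continuousAt.2 fun ⟨f, g⟩ => tendsto_isometry_iff.2 fun ε hε => ?_
    have hf := tendsto_isometry_iff.1 ((continuous_fst (X := N ≃ᵢ N) (Y := N ≃ᵢ N)).tendsto (f, g))
      (ε / 2) (half_pos hε)
    have hg := tendsto_isometry_iff.1 ((continuous_snd (X := N ≃ᵢ N) (Y := N ≃ᵢ N)).tendsto (f, g))
      (ε / 2) (half_pos hε)
    filter_upwards [hf, hg] with a ha hb x
    calc dist (a.1 (a.2 x)) (f (g x))
        ≤ dist (a.1 (a.2 x)) (a.1 (g x)) + dist (a.1 (g x)) (f (g x)) := dist_triangle _ _ _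
      _ = dist (a.2 x) (g x) + dist (a.1 (g x)) (f (g x)) := by rw [a.1.dist_eq]
      _ < ε := by linarith [ha (g x), hb x]
  continuous_inv := by
    refine continuous_iff_continuousAt.2 fun f => tendsto_isometry_iff.2 fun ε hε => ?_
    have hf := tendsto_isometry_iff.1 (Filter.tendsto_id (x := 𝓝 f)) ε hε
    filter_upwards [hf] with a ha x
    have h := ha (f⁻¹ x)
    rw [id, IsometryEquiv.apply_inv_self] at h
    calc dist (a⁻¹ x) (f⁻¹ x) = dist (a (a⁻¹ x)) (a (f⁻¹ x)) := (a.dist_eq _ _).symm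
      _ = dist (a (f⁻¹ x)) x := by rw [IsometryEquiv.apply_inv_self, dist_comm]
      _ < ε := h

variable (N) in
/-- The identity component of the isometry group of `N`. -/
abbrev identityComponentIsometries : Subgroup (N ≃ᵢ N) :=
  Subgroup.connectedComponentOfOne (N ≃ᵢ N)

variable (N) in
/-- `N` is homogeneous: its isometry group acts transitively. -/
def IsHomogeneous : Prop := ∀ p q : N, ∃ f : N ≃ᵢ N, f p = q

/-- `φ : N → 𝔼ᵐ` is equivariant: there is a continuous homomorphism `ψ` from the identity component
`G` of the isometry group of `N` to `SO(m)` with `φ (q p) = ψ(q) (φ p)`. (Continuous homomorphisms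
of Lie groups are automatically smooth, so these are the Lie group homomorphisms.) -/
def IsEquivariant {m : ℕ} (φ : N → EuclideanSpace ℝ (Fin m)) : Prop :=
  ∃ ψ : identityComponentIsometries N →ₜ* Matrix.specialOrthogonalGroup (Fin m) ℝ,
    ∀ (q : identityComponentIsometries N) (p : N),
      φ ((q : N ≃ᵢ N) p) =
        Matrix.toEuclideanLin (ψ q : Matrix (Fin m) (Fin m) ℝ) (φ p)

end IsometryGroup

section Riemannian

variable {n : ℕ} {N : Type*} [TopologicalSpace N] [ChartedSpace (EuclideanSpace ℝ (Fin n)) N]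

instance finiteDimensional_tangentSpace (p : N) : FiniteDimensional ℝ (TangentSpace (𝓡 n) p) :=
  inferInstanceAs (FiniteDimensional ℝ (EuclideanSpace ℝ (Fin n)))

section Canonical

variable {m : ℕ} (φ : N → EuclideanSpace ℝ (Fin m))

/-- The tangential component of the position vector `φ p`: its orthogonal projection to the
image of the differential of `φ` at `p`. -/
def tangentialComponent (p : N) : EuclideanSpace ℝ (Fin m) :=
  (LinearMap.range (mvfderiv (𝓡 n) φ p).toLinearMap).starProjection (φ p)

theorem exists_mvfderiv_eq_tangentialComponent (p : N) :
    ∃ v : TangentSpace (𝓡 n) p,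
      mvfderiv (𝓡 n) φ p v = tangentialComponent (n := n) φ p :=
  LinearMap.mem_range.1 (Submodule.starProjection_apply_mem _ _)

/-- The canonical vector field `xᵀ` on `N`: the vector field that `dφ` maps to the tangential
component of the position vector (unique when `φ` is an immersion). -/
def canonicalVectorField (p : N) : TangentSpace (𝓡 n) p :=
  (exists_mvfderiv_eq_tangentialComponent φ p).choose

theorem mvfderiv_canonicalVectorField (p : N) :
    mvfderiv (𝓡 n) φ p (canonicalVectorField φ p) = tangentialComponent (n := n) φ p :=
  (exists_mvfderiv_eq_tangentialComponent φ p).choose_spec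

end Canonical

variable [RiemannianBundle (fun p : N ↦ TangentSpace (𝓡 n) p)]

variable (n) in
/-- A smooth map into `𝔼ᵐ` whose differential preserves inner products; such a differential is
injective, so the map is an immersion. -/
structure IsIsometricImmersion {m : ℕ} (φ : N → EuclideanSpace ℝ (Fin m)) : Prop where
  contMDiff : ContMDiff (𝓡 n) (𝓡 m) ∞ φ
  inner_mvfderiv : ∀ (p : N) (u v : TangentSpace (𝓡 n) p),
    ⟪mvfderiv (𝓡 n) φ p u, mvfderiv (𝓡 n) φ p v⟫_ℝ = ⟪u, v⟫_ℝ

/-- The Riemannian metric in the preferred chart at `p`, at the point of the chart with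
coordinates `y`. -/
def chartMetric (p : N) (y u v : EuclideanSpace ℝ (Fin n)) : ℝ :=
  inner ℝ
    (mfderiv (𝓡 n) (𝓡 n) (extChartAt (𝓡 n) p).symm y u :
      TangentSpace (𝓡 n) ((extChartAt (𝓡 n) p).symm y))
    (mfderiv (𝓡 n) (𝓡 n) (extChartAt (𝓡 n) p).symm y v)

/-- The Christoffel symbol of the first kind at `p`, in the preferred chart at `p`:
`Γ(u, v; w) = (∂_u g(v, w) + ∂_v g(u, w) - ∂_w g(u, v)) / 2`. By construction of the tangent bundle
the preferred chart at `p` identifies `TangentSpace (𝓡 n) p` with `ℝⁿ`. -/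
def christoffel (p : N) (u v w : TangentSpace (𝓡 n) p) : ℝ :=
  (fderiv ℝ (fun y ↦ chartMetric p y v w) (extChartAt (𝓡 n) p p) u
    + fderiv ℝ (fun y ↦ chartMetric p y u w) (extChartAt (𝓡 n) p p) v
    - fderiv ℝ (fun y ↦ chartMetric p y u v) (extChartAt (𝓡 n) p p) w) / 2

/-- The components of a vector field in the preferred chart at `p`. -/
def chartVectorField (X : (p : N) → TangentSpace (𝓡 n) p) (p : N)
    (y : EuclideanSpace ℝ (Fin n)) : EuclideanSpace ℝ (Fin n) :=
  VectorField.mpullback (𝓡 n) (𝓡 n) (extChartAt (𝓡 n) p).symm X y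

/-- The coordinate derivative `∂_u X` at `p` of a vector field, in the preferred chart at `p`. -/
def chartDeriv (X : (p : N) → TangentSpace (𝓡 n) p) (p : N) (u : TangentSpace (𝓡 n) p) :
    TangentSpace (𝓡 n) p :=
  fderiv ℝ (chartVectorField X p) (extChartAt (𝓡 n) p p) u

/-- The Levi-Civita covariant derivative `∇_u X` at `p`, computed in the preferred chart at `p`:
`∂_u X + Γ(u, X)`, with the index of `Γ` raised by means of an orthonormal basis of the tangent
space. -/
def leviCivita (X : (p : N) → TangentSpace (𝓡 n) p) (p : N) (u : TangentSpace (𝓡 n) p) :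
    TangentSpace (𝓡 n) p :=
  chartDeriv X p u
    + ∑ k, christoffel p u (X p) (stdOrthonormalBasis ℝ (TangentSpace (𝓡 n) p) k) •
        stdOrthonormalBasis ℝ (TangentSpace (𝓡 n) p) k

/-- The divergence `∑ᵢ ⟪∇_{eᵢ} X, eᵢ⟫`, for an orthonormal basis `(eᵢ)` of the tangent space. -/
def divergence (X : (p : N) → TangentSpace (𝓡 n) p) (p : N) : ℝ :=
  ∑ i, ⟪leviCivita X p (stdOrthonormalBasis ℝ (TangentSpace (𝓡 n) p) i),
    stdOrthonormalBasis ℝ (TangentSpace (𝓡 n) p) i⟫_ℝ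

/-- A vector field is incompressible if it is smooth and its divergence vanishes at all points. -/
def IsIncompressible [IsManifold (𝓡 n) ∞ N] (X : (p : N) → TangentSpace (𝓡 n) p) : Prop :=
  ContMDiff (𝓡 n) (𝓡 n).tangent ∞ (fun p ↦ (⟨p, X p⟩ : TangentBundle (𝓡 n) N)) ∧
    ∀ p, divergence X p = 0

end Riemannian

end

/-! ### Transitivity of the identity component of a compact group -/

section TransitiveAction

variable {G X : Type*} [Group G] [TopologicalSpace G] [IsTopologicalGroup G] [CompactSpace G]
  [TopologicalSpace X] [T2Space X] [MulAction G X] [ContinuousSMul G X]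
  [MulAction.IsPretransitive G X]

/-! The canonical field is identically zero, so its divergence vanishes trivially. The identity
component of the compact isometry group is already transitive on the connected space `N`, so
equivariance under orthogonal matrices makes `‖φ‖` constant (`IsEquivariant.norm_eq`).
Differentiating `‖φ‖²` shows that the position vector is normal, and `dφ` is injective.

Transitivity of the identity component needs no Lie structure: an open subgroup has open orbits,
hence a single one, and compactness carries this over to the intersection of all open subgroups. -/

open scoped Pointwise in
/-- The orbits of an open subgroup of a compact group acting transitively on a Hausdorff space are
open. -/
theorem OpenSubgroup.isOpen_orbit (U : OpenSubgroup G) (x : X) :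
    IsOpen (MulAction.orbit (U : Subgroup G) x) := by
  have hc : Continuous fun g : G ↦ g • x := continuous_id.smul continuous_const
  -- A continuous surjection from a compact space to a Hausdorff space is a quotient map, so
  -- openness can be tested in `G`.
  have hq : IsQuotientMap fun g : G ↦ g • x :=
    hc.isClosedMap.isQuotientMap hc (MulAction.surjective_smul G x)
  rw [← hq.isOpen_preimage]
  have h : (fun g : G ↦ g • x) ⁻¹' MulAction.orbit (U : Subgroup G) x
      = (U : Set G) * (MulAction.stabilizer G x : Set G) := by
    ext g
    constructor
    · rintro ⟨u, hu⟩
      refine ⟨u, u.2, (u : G)⁻¹ * g, ?_, by simp⟩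
      change ((u : G)⁻¹ * g) • x = x
      rw [mul_smul, inv_smul_eq_iff]
      exact hu.symm
    · rintro ⟨u, hu, h, hh, rfl⟩
      refine ⟨⟨u, hu⟩, ?_⟩
      change u • x = (u * h) • x
      rw [mul_smul, show h • x = x from hh]
  rw [h]
  exact U.isOpen.mul_right

/-- An open subgroup of a compact group acting transitively on a connected Hausdorff space acts
transitively. -/
theorem OpenSubgroup.orbit_eq_univ [ConnectedSpace X] (U : OpenSubgroup G) (x : X) :
    MulAction.orbit (U : Subgroup G) x = Set.univ := by
  refine IsClopen.eq_univ ⟨⟨?_⟩, U.isOpen_orbit x⟩ ⟨x, MulAction.mem_orbit_self x⟩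
  -- The complement of an orbit is a union of orbits, hence open.
  have h : (MulAction.orbit (U : Subgroup G) x)ᶜ
      = ⋃ y ∈ (MulAction.orbit (U : Subgroup G) x)ᶜ, MulAction.orbit (U : Subgroup G) y := by
    ext z
    simp only [Set.mem_iUnion, exists_prop]
    refine ⟨fun hz ↦ ⟨z, hz, MulAction.mem_orbit_self z⟩, ?_⟩
    rintro ⟨y, hy, hzy⟩ hzx
    exact hy ((MulAction.orbit_eq_iff.2 hzx) ▸ MulAction.mem_orbit_symm.1 hzy)
  rw [h]
  exact isOpen_biUnion fun y _ ↦ U.isOpen_orbit y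

/-- The identity component of a compact Hausdorff group acting transitively on a connected
Hausdorff space acts transitively. -/
theorem exists_mem_connectedComponentOfOne_smul_eq [T2Space G] [ConnectedSpace X] (x y : X) :
    ∃ g ∈ Subgroup.connectedComponentOfOne G, g • x = y := by
  have hc : Continuous fun g : G ↦ g • x := continuous_id.smul continuous_const
  have hclosed (U : OpenSubgroup G) : IsClosed ((U : Set G) ∩ {g : G | g • x = y}) :=
    U.isClosed.inter (isClosed_eq hc continuous_const)
  -- Cantor intersection: one `g` sends `x` to `y` and lies in every open subgroup.
  obtain ⟨g, hg⟩ := IsCompact.nonempty_iInter_of_directed_nonempty_isCompact_isClosed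
    (fun U : OpenSubgroup G ↦ (U : Set G) ∩ {g : G | g • x = y})
    (fun U V ↦ ⟨U ⊓ V, fun g hg ↦ ⟨hg.1.1, hg.2⟩, fun g hg ↦ ⟨hg.1.2, hg.2⟩⟩)
    (fun U ↦ by
      obtain ⟨u, hu⟩ : y ∈ MulAction.orbit (U : Subgroup G) x := by
        rw [U.orbit_eq_univ x]; trivial
      exact ⟨u, u.2, hu⟩)
    (fun U ↦ (hclosed U).isCompact) hclosed
  rw [Set.mem_iInter] at hg
  refine ⟨g, ?_, (hg ⊤).2⟩
  change g ∈ connectedComponent (1 : G)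
  -- The component of `1` is the intersection of its clopen neighbourhoods, each of which contains
  -- an open subgroup.
  rw [connectedComponent_eq_iInter_isClopen, Set.mem_iInter]
  rintro ⟨W, hW, h1⟩
  obtain ⟨U, hU⟩ := IsTopologicalGroup.exist_openSubgroup_sub_clopen_nhds_of_one hW h1
  exact hU (hg U).1

end TransitiveAction

/-! ### Compactness of the isometry group -/

section IsometryGroup

variable {N : Type*} [MetricSpace N] [CompactSpace N]

theorem isEmbedding_isometryToContinuousMap : IsEmbedding (isometryToContinuousMap (N := N)) :=
  ⟨⟨rfl⟩, fun _ _ h ↦ IsometryEquiv.ext fun x ↦ DFunLike.congr_fun h x⟩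

/-- The isometries form a closed subset of the space of continuous self-maps. -/
theorem isClosed_range_isometryToContinuousMap :
    IsClosed (Set.range (isometryToContinuousMap (N := N))) := by
  refine isClosed_of_closure_subset fun f hf ↦ ?_
  rw [Metric.mem_closure_iff] at hf
  have hiso : Isometry f := by
    have hcl : IsClosed {h : C(N, N) | ∀ x y, dist (h x) (h y) = dist x y} := by
      simp only [Set.ofPred_forall]
      exact isClosed_iInter fun x ↦ isClosed_iInter fun y ↦ isClosed_eq (by fun_prop) (by fun_prop)
    refine Isometry.of_dist_eq (hcl.closure_subset_iff.2 ?_ (Metric.mem_closure_iff.2 hf))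
    rintro _ ⟨g, rfl⟩ x y
    exact g.dist_eq x y
  -- If an isometry `g` is uniformly `ε`-close to `f`, then `f (g.symm y)` is `ε`-close to `y`; the
  -- range of `f` is closed.
  have hsurj : Function.Surjective f := fun y ↦ by
    have hr : IsClosed (Set.range f) := (isCompact_range f.continuous).isClosed
    refine hr.closure_subset (Metric.mem_closure_iff.2 fun ε hε ↦ ?_)
    obtain ⟨_, ⟨g, rfl⟩, hg⟩ := hf ε hε
    refine ⟨_, ⟨g.symm y, rfl⟩, ?_⟩
    have h := (ContinuousMap.dist_apply_le_dist (f := f) (g := isometryToContinuousMap g)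
      (g.symm y)).trans_lt hg
    rw [dist_comm] at h
    simpa [isometryToContinuousMap] using h
  exact ⟨⟨Equiv.ofBijective f ⟨hiso.injective, hsurj⟩, hiso⟩, rfl⟩

/-- The isometry group of a compact metric space is compact. -/
instance isometryGroup_compactSpace : CompactSpace (N ≃ᵢ N) := by
  have hcl : IsClosed (Set.range fun f : N ≃ᵢ N ↦
      BoundedContinuousFunction.mkOfCompact (isometryToContinuousMap f)) := by
    have := (ContinuousMap.isometryEquivBoundedOfCompact N N).toHomeomorph.isClosedMap _
      (isClosed_range_isometryToContinuousMap (N := N))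
    rwa [← Set.range_comp] at this
  -- Isometries share the modulus of continuity `id`, so Arzelà–Ascoli applies.
  have hcomp := BoundedContinuousFunction.arzela_ascoli₁ _ hcl (by
    refine Metric.equicontinuous_of_continuity_modulus id Filter.tendsto_id _ ?_
    rintro x y ⟨_, f, rfl⟩
    exact (f.dist_eq x y).le)
  have hemb : IsEmbedding fun f : N ≃ᵢ N ↦
      BoundedContinuousFunction.mkOfCompact (isometryToContinuousMap f) :=
    (ContinuousMap.isometryEquivBoundedOfCompact N N).toHomeomorph.isEmbedding.comp
      isEmbedding_isometryToContinuousMap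
  exact ⟨hemb.isCompact_iff.2 (by rwa [Set.image_univ])⟩

instance isometryGroup_t2Space : T2Space (N ≃ᵢ N) :=
  isEmbedding_isometryToContinuousMap.t2Space

/-- The tautological action of the isometry group. -/
instance isometryGroup_mulAction : MulAction (N ≃ᵢ N) N where
  smul f x := f x
  one_smul _ := rfl
  mul_smul _ _ _ := rfl

instance isometryGroup_continuousSMul : ContinuousSMul (N ≃ᵢ N) N where
  continuous_smul := by
    have h : Continuous fun a : C(N, N) × N ↦ a.1 a.2 := by fun_prop
    exact h.comp ((isEmbedding_isometryToContinuousMap.continuous.comp continuous_fst).prodMk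
      continuous_snd)

/-- The identity component of the isometry group of a compact connected homogeneous space acts
transitively. -/
theorem IsHomogeneous.exists_identityComponent_apply_eq [ConnectedSpace N] (hN : IsHomogeneous N)
    (p q : N) : ∃ g : identityComponentIsometries N, (g : N ≃ᵢ N) p = q := by
  have : MulAction.IsPretransitive (N ≃ᵢ N) N := ⟨hN⟩
  obtain ⟨g, hg, h⟩ := exists_mem_connectedComponentOfOne_smul_eq (G := N ≃ᵢ N) p q
  exact ⟨⟨g, hg⟩, h⟩

theorem norm_toEuclideanLin_specialOrthogonalGroup {m : ℕ}
    (A : Matrix.specialOrthogonalGroup (Fin m) ℝ) (v : EuclideanSpace ℝ (Fin m)) :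
    ‖Matrix.toEuclideanLin (A : Matrix (Fin m) (Fin m) ℝ) v‖ = ‖v‖ := by
  have hA : (A : Matrix (Fin m) (Fin m) ℝ).conjTranspose * (A : Matrix (Fin m) (Fin m) ℝ) = 1 :=
    Matrix.mem_unitaryGroup_iff'.1 (Matrix.mem_specialOrthogonalGroup_iff.1 A.2).1
  have h : ⟪Matrix.toEuclideanLin (A : Matrix (Fin m) (Fin m) ℝ) v,
      Matrix.toEuclideanLin (A : Matrix (Fin m) (Fin m) ℝ) v⟫_ℝ = ⟪v, v⟫_ℝ := by
    rw [← LinearMap.adjoint_inner_right, ← Matrix.toEuclideanLin_conjTranspose_eq_adjoint,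
      ← LinearMap.comp_apply]
    congr 1
    ext i
    rw [Matrix.conjTranspose_eq_transpose_of_trivial] at hA
    simp [Matrix.toLpLin_apply, Matrix.mulVec_mulVec, hA]
  rw [real_inner_self_eq_norm_sq, real_inner_self_eq_norm_sq] at h
  exact (sq_eq_sq₀ (norm_nonneg _) (norm_nonneg _)).1 h

/-- An equivariant map of a compact connected homogeneous space takes values in a sphere centered
at the origin. -/
theorem IsEquivariant.norm_eq [ConnectedSpace N] (hN : IsHomogeneous N) {m : ℕ}
    {φ : N → EuclideanSpace ℝ (Fin m)} (hφ : IsEquivariant φ) (p q : N) : ‖φ p‖ = ‖φ q‖ := by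
  obtain ⟨ψ, hψ⟩ := hφ
  obtain ⟨g, rfl⟩ := hN.exists_identityComponent_apply_eq p q
  rw [hψ, norm_toEuclideanLin_specialOrthogonalGroup]

end IsometryGroup

/-! ### Vanishing of the canonical field and of its divergence -/

section Riemannian

variable {n : ℕ} {N : Type*} [TopologicalSpace N] [ChartedSpace (EuclideanSpace ℝ (Fin n)) N]

/-- The position vector of a map into a sphere centered at the origin is normal. -/
theorem inner_mvfderiv_eq_zero_of_norm_eq {m : ℕ} {φ : N → EuclideanSpace ℝ (Fin m)} {p : N}
    (hφ : MDifferentiableAt (𝓡 n) (𝓡 m) φ p) (hnorm : ∀ q, ‖φ q‖ = ‖φ p‖)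
    (v : TangentSpace (𝓡 n) p) : ⟪φ p, mvfderiv (𝓡 n) φ p v⟫_ℝ = 0 := by
  have hd : HasFDerivAt (fun x : EuclideanSpace ℝ (Fin m) ↦ ‖x‖ ^ 2) (2 • innerSL ℝ (φ p)) (φ p) :=
    (hasStrictFDerivAt_norm_sq (φ p)).hasFDerivAt
  have hcomp := mvfderiv_comp_apply (I := 𝓡 m) (I' := 𝓡 n)
    (g := fun x : EuclideanSpace ℝ (Fin m) ↦ ‖x‖ ^ 2)
    p hd.differentiableAt.mdifferentiableAt hφ v
  have hconst : (fun x : EuclideanSpace ℝ (Fin m) ↦ ‖x‖ ^ 2) ∘ φ = fun _ ↦ ‖φ p‖ ^ 2 :=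
    funext fun q ↦ by simp [hnorm q]
  rw [hconst, mvfderiv_const] at hcomp
  have h2 : mvfderiv (𝓡 m) (fun x : EuclideanSpace ℝ (Fin m) ↦ ‖x‖ ^ 2) (φ p)
      = 2 • innerSL ℝ (φ p) := by
    have := hd.hasMFDerivAt.mfderiv
    ext w
    simp only [mvfderiv, this]
    rfl
  rw [h2] at hcomp
  have h3 : (0 : ℝ) = 2 • ⟪φ p, mvfderiv (𝓡 n) φ p v⟫_ℝ := hcomp
  simpa using h3.symm

variable [RiemannianBundle (fun p : N ↦ TangentSpace (𝓡 n) p)]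

/-- The canonical vector field of an isometric immersion into a sphere centered at the origin
vanishes. -/
theorem IsIsometricImmersion.canonicalVectorField_eq_zero {m : ℕ}
    {φ : N → EuclideanSpace ℝ (Fin m)} (hφ : IsIsometricImmersion n φ)
    (hnorm : ∀ p q, ‖φ p‖ = ‖φ q‖) :
    canonicalVectorField (n := n) φ = 0 := by
  funext p
  have ht : tangentialComponent (n := n) φ p = 0 := by
    refine (Submodule.starProjection_apply_eq_zero_iff _).2 ?_
    rw [Submodule.mem_orthogonal']
    rintro _ ⟨v, rfl⟩
    exact inner_mvfderiv_eq_zero_of_norm_eq (hφ.contMDiff.mdifferentiable (by simp) p)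
      (fun q ↦ hnorm q p) v
  -- The squared length of the field equals that of its image under `dφ`, which is zero.
  have h := hφ.inner_mvfderiv p (canonicalVectorField φ p) (canonicalVectorField φ p)
  rw [mvfderiv_canonicalVectorField, ht, inner_zero_left] at h
  exact inner_self_eq_zero.1 h.symm

theorem chartMetric_zero_left (p : N) (y v : EuclideanSpace ℝ (Fin n)) :
    chartMetric p y 0 v = 0 :=
  (congrArg (fun t ↦ inner ℝ t (mfderiv (𝓡 n) (𝓡 n) (extChartAt (𝓡 n) p).symm y v))
    (map_zero (mfderiv (𝓡 n) (𝓡 n) (extChartAt (𝓡 n) p).symm y))).trans (inner_zero_left _)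

theorem chartMetric_zero_right (p : N) (y u : EuclideanSpace ℝ (Fin n)) :
    chartMetric p y u 0 = 0 :=
  (congrArg (fun t ↦ inner ℝ (mfderiv (𝓡 n) (𝓡 n) (extChartAt (𝓡 n) p).symm y u) t)
    (map_zero (mfderiv (𝓡 n) (𝓡 n) (extChartAt (𝓡 n) p).symm y))).trans (inner_zero_right _)

/-- Two terms differentiate a metric coefficient with a zero entry; the third is a derivative in the
zero direction. -/
theorem christoffel_zero_middle (p : N) (u w : TangentSpace (𝓡 n) p) :
    christoffel p u 0 w = 0 := by
  have h (x u w : EuclideanSpace ℝ (Fin n)) :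
      (fderiv ℝ (fun y ↦ chartMetric p y 0 w) x u + fderiv ℝ (fun y ↦ chartMetric p y u w) x 0
        - fderiv ℝ (fun y ↦ chartMetric p y u 0) x w) / 2 = 0 := by
    simp [chartMetric_zero_left, chartMetric_zero_right]
  exact h _ u w

theorem leviCivita_zero (p : N) (u : TangentSpace (𝓡 n) p) :
    leviCivita (0 : (p : N) → TangentSpace (𝓡 n) p) p u = 0 := by
  have h : chartVectorField (0 : (p : N) → TangentSpace (𝓡 n) p) p = fun _ ↦ 0 := by
    funext y
    -- `inverse` is linear even at points where the derivative is not invertible, so no condition on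
    -- `y` is needed.
    exact map_zero (mfderiv (𝓡 n) (𝓡 n) (extChartAt (𝓡 n) p).symm y).inverse
  have hd : chartDeriv (0 : (p : N) → TangentSpace (𝓡 n) p) p u = 0 := by
    unfold chartDeriv
    rw [h, fderiv_fun_const]
    rfl
  unfold leviCivita
  rw [hd, zero_add]
  exact Finset.sum_eq_zero fun k _ ↦ by
    rw [Pi.zero_apply, christoffel_zero_middle, zero_smul]

theorem isIncompressible_zero [IsManifold (𝓡 n) ∞ N] :
    IsIncompressible (0 : (p : N) → TangentSpace (𝓡 n) p) :=
  ⟨Bundle.contMDiff_zeroSection ℝ (TangentSpace (𝓡 n) : N → Type _), fun p ↦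
    Finset.sum_eq_zero fun i _ ↦ by rw [leviCivita_zero, inner_zero_left]⟩

end Riemannian

theorem theorem3p2 {n m : ℕ} {N : Type*} [MetricSpace N] [CompactSpace N] [ConnectedSpace N]
    [ChartedSpace (EuclideanSpace ℝ (Fin n)) N] [IsManifold (𝓡 n) ∞ N]
    [RiemannianBundle (fun p : N ↦ TangentSpace (𝓡 n) p)]
    [IsContMDiffRiemannianBundle (𝓡 n) ∞ (EuclideanSpace ℝ (Fin n))
      (fun p : N ↦ TangentSpace (𝓡 n) p)]
    [IsRiemannianManifold (𝓡 n) N]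
    (hN : IsHomogeneous N)
    (φ : N → EuclideanSpace ℝ (Fin m))
    (hφ : IsIsometricImmersion n φ)
    (hφ_equiv : IsEquivariant φ) :
    IsIncompressible (n := n) (canonicalVectorField (n := n) φ) := by
  rw [hφ.canonicalVectorField_eq_zero (hφ_equiv.norm_eq hN)]
  exact isIncompressible_zero
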